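/- For $\theta\in\mathbb R^n$ let $P_\theta=\bigotimes_{i=1}^n\mathcal N(\theta_i,1)$ be the law of $X=(X_1,\dots,X_n)$, let $S(\theta)=\{i:\theta_i\ne0\}$, let $\phi$ be the standard normal density, $g(x)=(2\pi)^{-1/2}x^{-2}(1-e^{-x^2/2})$ (extended continuously to $x=0$), and let $\overline\Phi,\overline G$ be the upper tail functions of the densities $\phi,g$. For $w\in[0,1]$ put $$\ell(x;w)=\frac{(1-w)\phi(x)}{(1-w)\phi(x)+wg(x)},\qquad q(x;w)=\frac{(1-w)\overline\Phi(|x|)}{(1-w)\overline\Phi(|x|)+w\overline G(|x|)},$$ and let $\hat w$ be the (almost surely unique) maximiser over $w\in[1/n,1]$ of the marginal log-likelihood $\sum_{i=1}^n\log\big((1-w)\phi(X_i)+wg(X_i)\big)$. Fix $t\in(0,1)$. The $q$-value procedure at level $t$ is $\varphi^{q}_i=\mathbf 1\{q(X_i;\hat w)<t\}$, $1\le i\le n$. The $C\ell$-value procedure at level $t$ is $\varphi^{C\ell}_i=\mathbf 1\{\ell(X_i;\hat w)<\hat\lambda\}$, $1\le i\le n$, where $$\hat\lambda=\sup\Big\{\lambda\in[0,1]:\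 \frac{\sum_{i=1}^n\ell(X_i;\hat w)\mathbf 1\{\ell(X_i;\hat w)<\lambda\}}{1\vee\sum_{i=1}^n\mathbf 1\{\ell(X_i;\hat w)<\lambda\}}\le t\Big\}.$$ Let $(s_n)$ be a sequence of non-negative integers with $s_n\to\infty$ and $s_n/n\to0$, let $b\in\mathbb R$ be fixed, and let $$\ell_0(s_n;b)=\big\{\theta\in\mathbb R^n:\ |S(\theta)|=s_n,\ |\theta_i|\ge\sqrt{2\log(n/s_n)}+b\ \text{ for all } i\in S(\theta)\big\}.$$ Then, for each of the two procedures $\varphi\in\{\varphi^{C\ell},\varphi^{q}\}$: 1. $\varphi$ is sparsity preserving over $\ell_0(s_n;b)$ at every level $A_n\to\infty$: for every real sequence $A_n\to\infty$, $$\sup_{\theta\in\ell_0(s_n;b)}P_\theta\Big(\sum_{i=1}^n\varphi_i>A_ns_n\Big)\longrightarrow0\qquad(n\to\infty).$$ 2. The false negative rate of $\varphi$ does not vanish over $\ell_0(s_n;b)$: $$\liminf_{n\to\infty}\ \sup_{\theta\in\ell_0(s_n;b)}E_\theta\Big[\frac{\#\{i\in S(\theta):\varphi_i=0\}}{1\vee|S(\theta)|}\Big]\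 \ge\ \overline\Phi(b),$$ which is positive; hence in the result that the false negative rate of $\varphi$ tends to $0$ uniformly over $\ell_0(s_n;v_n)$ whenever $v_n\to\infty$, the condition $v_n\to\infty$ cannot be replaced by $v_n=b$. -/

import Mathlib

open Filter Topology MeasureTheory ProbabilityTheory
open scoped ENNReal

namespace SparseTesting

noncomputable section

/-- The standard Gaussian density. -/
def phi (x : ℝ) : ℝ := gaussianPDFReal 0 1 x

/-- The quasi-Cauchy marginal density `(2π)^(-1/2) x^(-2) (1 - exp (-x^2/2))`, extended to `x = 0`
by continuity. It is the convolution of `phi` with the quasi-Cauchy slab density. -/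
def g (x : ℝ) : ℝ :=
  if x = 0 then (√(2 * Real.pi))⁻¹ / 2
  else (√(2 * Real.pi))⁻¹ * (x ^ 2)⁻¹ * (1 - Real.exp (-x ^ 2 / 2))

/-- The upper tail function of a density. -/
def upperTail (f : ℝ → ℝ) (x : ℝ) : ℝ := ∫ u in Set.Ioi x, f u

/-- The `ℓ`-value function: the posterior probability of the null, given the observation `x`, under
the spike-and-slab prior with weight `w`. -/
def lval (x w : ℝ) : ℝ := (1 - w) * phi x / ((1 - w) * phi x + w * g x)

/-- The `q`-value function. -/
def qval (x w : ℝ) : ℝ :=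
  (1 - w) * upperTail phi |x| / ((1 - w) * upperTail phi |x| + w * upperTail g |x|)

/-- The marginal log-likelihood of the weight `w`. -/
def logLik {n : ℕ} (X : Fin n → ℝ) (w : ℝ) : ℝ :=
  ∑ i, Real.log ((1 - w) * phi (X i) + w * g (X i))

/-- The maximisers of the marginal log-likelihood over `[1/n, 1]`. -/
def mleSet {n : ℕ} (X : Fin n → ℝ) : Set ℝ :=
  {w | w ∈ Set.Icc (1 / (n : ℝ)) 1 ∧ IsMaxOn (logLik X) (Set.Icc (1 / (n : ℝ)) 1) w}

/-- The marginal maximum likelihood estimator of the weight. The maximiser is almost surely unique;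
on the exceptional null set the largest one is taken. -/
def wHat {n : ℕ} (X : Fin n → ℝ) : ℝ := sSup (mleSet X)

lemma g_pos (x : ℝ) : 0 < g x := by
  unfold g
  split_ifs with h
  · positivity
  · have : Real.exp (-x^2/2) < 1 := by
      rw [Real.exp_lt_one_iff]; have := sq_pos_of_ne_zero h; linarith
    have h2 := sub_pos.2 this
    positivity
lemma phi_pos (x : ℝ) : 0 < phi x := gaussianPDFReal_pos 0 1 x (by norm_num)

/-- The argmax set is never empty and contains its supremum, so `wHat` is a maximiser. -/
theorem wHat_mem {n : ℕ} (X : Fin n → ℝ) : wHat X ∈ mleSet X := by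
  have h0 : ∀ w ∈ Set.Icc (1 / (n : ℝ)) 1, ∀ x, (1 - w) * phi x + w * g x ≠ 0 := by
    intro w hw x
    have hw0 : 0 ≤ w := le_trans (by positivity) hw.1
    have h1 := phi_pos x
    have h2 := g_pos x
    rcases eq_or_lt_of_le hw.2 with h | h
    · subst h; simp; exact h2.ne'
    · have := mul_pos (sub_pos.2 h) h1
      have := mul_nonneg hw0 h2.le
      linarith
  have hc : ContinuousOn (logLik X) (Set.Icc (1 / (n : ℝ)) 1) := by
    unfold logLik
    refine continuousOn_finsetSum _ fun i _ => ContinuousOn.log (by fun_prop) ?_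
    exact fun w hw => h0 w hw _
  have hne : (Set.Icc (1 / (n : ℝ)) 1).Nonempty := by
    rw [Set.nonempty_Icc]
    rcases Nat.eq_zero_or_pos n with h | h
    · simp [h]
    · rw [div_le_one (by positivity)]; exact_mod_cast h
  obtain ⟨w, hw, hm⟩ := isCompact_Icc.exists_isMaxOn hne hc
  have heq : mleSet X = Set.Icc (1 / (n : ℝ)) 1 ∩ logLik X ⁻¹' (Set.Ici (logLik X w)) := by
    ext v
    constructor
    · rintro ⟨hv, hmv⟩; exact ⟨hv, hmv hw⟩
    · rintro ⟨hv, hmv⟩; exact ⟨hv, fun u hu => (show logLik X u ≤ logLik X w from hm hu).trans hmv⟩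
  have hcl : IsClosed (mleSet X) := by
    rw [heq]; exact hc.preimage_isClosed_of_isClosed isClosed_Icc isClosed_Ici
  exact hcl.csSup_mem ⟨w, hw, hm⟩ ⟨1, fun v hv => hv.1.2⟩

/-- A multiple testing procedure for `n` hypotheses, given by its set of rejected hypotheses
`{i | φ_i(X) = 1}`. -/
abbrev Procedure (n : ℕ) : Type := (Fin n → ℝ) → Finset (Fin n)

/-- The procedure that rejects the hypotheses whose `ℓ`-value with weight `w` is below `lam`. -/
def lvalProc (n : ℕ) (lam w : ℝ) : Procedure n :=
  fun X => Finset.univ.filter (fun i => lval (X i) w < lam)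

/-- The posterior FDR, with weight `w`, of a procedure whose rejection set on the data `X` is `R`. -/
def postFDR {n : ℕ} (w : ℝ) (X : Fin n → ℝ) (R : Finset (Fin n)) : ℝ :=
  (∑ i ∈ R, lval (X i) w) / max 1 (R.card : ℝ)

/-- The threshold of the `Cℓ`-value procedure. -/
def lamHat {n : ℕ} (t w : ℝ) (X : Fin n → ℝ) : ℝ :=
  sSup {lam | lam ∈ Set.Icc (0 : ℝ) 1 ∧ postFDR w X (lvalProc n lam w X) ≤ t}

/-- The `Cℓ`-value procedure at level `t`. -/
def clProc (t : ℝ) (n : ℕ) : Procedure n :=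
  fun X => lvalProc n (lamHat t (wHat X) X) (wHat X) X

/-- The `q`-value procedure at level `t`. -/
def qProc (t : ℝ) (n : ℕ) : Procedure n :=
  fun X => Finset.univ.filter (fun i => qval (X i) (wHat X) < t)

/-- The law of the data in the Gaussian sequence model with mean vector `θ`. -/
def law {n : ℕ} (θ : Fin n → ℝ) : Measure (Fin n → ℝ) :=
  Measure.pi (fun i => gaussianReal (θ i) 1)

/-- The support of `θ`. -/
def supp {n : ℕ} (θ : Fin n → ℝ) : Finset (Fin n) := Finset.univ.filter (fun i => θ i ≠ 0)

/-- The signal class `ℓ₀(s; v)` in `ℝⁿ`. -/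
def signalClass (n s : ℕ) (v : ℝ) : Set (Fin n → ℝ) :=
  {θ | (supp θ).card = s ∧ ∀ i ∈ supp θ, √(2 * Real.log ((n : ℝ) / s)) + v ≤ |θ i|}

/-- The false negative rate at `θ`, the expectation of a `[0, 1]`-valued random variable, as a
number in `[0, ∞]`. -/
def FNR {n : ℕ} (φ : Procedure n) (θ : Fin n → ℝ) : ℝ≥0∞ :=
  ∫⁻ X, ((supp θ \ φ X).card : ℝ≥0∞) / max 1 ((supp θ).card : ℝ≥0∞) ∂(law θ)

/-- The sequence `φ` of procedures is sparsity preserving at level `A n` over the sets `Θ n`: the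
probability of more than `A n * s n` rejections tends to zero uniformly over `Θ n`. -/
def SparsityPreserving (φ : ∀ n, Procedure n) (s : ℕ → ℕ) (A : ℕ → ℝ)
    (Θ : ∀ n, Set (Fin n → ℝ)) : Prop :=
  Tendsto (fun n => ⨆ θ ∈ Θ n, law θ {X | A n * (s n : ℝ) < ((φ n X).card : ℝ)}) atTop (𝓝 0)

end

end SparseTesting

namespace SparseTesting

/-! Write `a` for `signalRate s n`, so that `exp (-a²/2) = s/n`. The estimated weight is of order at
most `a s/n`: by concavity of the log-likelihood, `ŵ > w` forces the score at `w` to be nonnegative,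
and a Chernoff bound makes this exponentially unlikely in `s` at `w = 192 a s/n` (`law_lt_wHat_le`).
For such weights a `q`-value below a fixed `c < 1` forces a Gaussian tail `upperTail phi |x|` of
order `s/n`, because the slab tail contributes a factor `1/a` (`tail_le_of_qval_lt`). Only `O(s)`
coordinates satisfy this, signals included. The `Cℓ` procedure reduces to this count, since a
posterior FDR at most `t < c` forces a fixed proportion of rejected `ℓ`-values below `c`, and `q ≤
ℓ`.

The false negative bound uses only sparsity preservation, at level `a`, and monotonicity in `|X i|`
(`le_liminf_iSup_FNR`). For fixed `ε > 0`, with high probability more than `a s` coordinates exceed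
`a - ε`, so rejecting anything at or below that height would cause too many rejections. A signal
placed at `a + b` is then missed whenever its noise is below about `-b - ε`; let `ε` tend to `0`. -/

/-! ### Densities and their likelihood ratio -/

lemma phi_eq (x : ℝ) : phi x = (√(2 * Real.pi))⁻¹ * Real.exp (-x ^ 2 / 2) := by
  simp [phi, gaussianPDFReal]

lemma phi_abs (x : ℝ) : phi |x| = phi x := by simp [phi_eq]

lemma g_abs (x : ℝ) : g |x| = g x := by simp [g]

lemma measurable_phi : Measurable phi := measurable_gaussianPDFReal 0 1

lemma measurable_g : Measurable g := by
  unfold g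
  exact Measurable.ite (measurableSet_singleton 0) measurable_const (by fun_prop)

lemma integrable_phi : Integrable phi := integrable_gaussianPDFReal 0 1

lemma integral_phi : ∫ x, phi x = 1 := integral_gaussianPDFReal_eq_one 0 one_ne_zero

lemma inv_sqrt_two_pi_pos : 0 < (√(2 * Real.pi))⁻¹ := by positivity

lemma inv_sqrt_two_pi_le_one : (√(2 * Real.pi))⁻¹ ≤ 1 := by
  apply inv_le_one_of_one_le₀
  rw [Real.one_le_sqrt]
  linarith [Real.pi_gt_three]

lemma third_le_inv_sqrt_two_pi : 1 / 3 ≤ (√(2 * Real.pi))⁻¹ := by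
  rw [one_div]
  apply inv_anti₀ (by positivity)
  rw [Real.sqrt_le_left (by norm_num)]
  linarith [Real.pi_lt_d2]

lemma g_of_ne {x : ℝ} (hx : x ≠ 0) :
    g x = (√(2 * Real.pi))⁻¹ * (x ^ 2)⁻¹ * (1 - Real.exp (-x ^ 2 / 2)) := by
  simp [g, hx]

/-- The likelihood ratio of the slab marginal and the null density. -/
noncomputable def lratio (x : ℝ) : ℝ := g x / phi x

lemma g_eq (x : ℝ) : g x = lratio x * phi x := by
  rw [lratio, div_mul_cancel₀ _ (phi_pos x).ne']

lemma measurable_lratio : Measurable lratio := measurable_g.div measurable_phi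

lemma lratio_abs (x : ℝ) : lratio |x| = lratio x := by simp [lratio, g_abs, phi_abs]

lemma lratio_of_ne {x : ℝ} (hx : x ≠ 0) : lratio x = (Real.exp (x ^ 2 / 2) - 1) / x ^ 2 := by
  have h : Real.exp (-(x ^ 2 / 2)) * Real.exp (x ^ 2 / 2) = 1 := by
    rw [← Real.exp_add]; simp
  rw [lratio, g_of_ne hx, phi_eq, div_eq_div_iff (by positivity) (by positivity)]
  have h2 := inv_sqrt_two_pi_pos
  field_simp
  linear_combination -h

lemma lratio_zero : lratio 0 = 1 / 2 := by
  have h2 := inv_sqrt_two_pi_pos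
  rw [lratio, phi_eq, g, if_pos rfl]
  field_simp
  simp

lemma half_le_lratio (x : ℝ) : 1 / 2 ≤ lratio x := by
  rcases eq_or_ne x 0 with rfl | hx
  · rw [lratio_zero]
  · rw [lratio_of_ne hx, le_div_iff₀ (by positivity)]
    linarith [Real.add_one_le_exp (x ^ 2 / 2)]

/-- With `u = x²/2` the ratio is `(exp u - 1) / (2u)`, half a secant slope of the convex function
`exp` from `0`. -/
lemma lratio_mono {x y : ℝ} (h : |x| ≤ |y|) : lratio x ≤ lratio y := by
  rcases eq_or_ne x 0 with rfl | hx
  · rw [lratio_zero]; exact half_le_lratio y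
  have hy : y ≠ 0 := by
    rintro rfl
    simp at h
    exact hx h
  have hsq : x ^ 2 / 2 ≤ y ^ 2 / 2 := by
    have := sq_le_sq.2 h
    linarith
  have h1 := convexOn_exp.secant_mono (a := 0) (x := x ^ 2 / 2) (y := y ^ 2 / 2) trivial trivial
    trivial (by positivity) (by positivity) hsq
  rw [lratio_of_ne hx, lratio_of_ne hy]
  simp only [Real.exp_zero, sub_zero, div_div_eq_mul_div] at h1
  have e : ∀ z : ℝ, (Real.exp (z ^ 2 / 2) - 1) / z ^ 2
      = (Real.exp (z ^ 2 / 2) - 1) * 2 / z ^ 2 / 2 := fun z => by ring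
  rw [e x, e y]
  linarith

lemma one_sub_exp_le (x : ℝ) : 1 - Real.exp (-x ^ 2 / 2) ≤ x ^ 2 / 2 := by
  linarith [Real.add_one_le_exp (-x ^ 2 / 2)]

lemma g_le_inv_sq (x : ℝ) (hx : x ≠ 0) : g x ≤ (x ^ 2)⁻¹ := by
  rw [g_of_ne hx]
  have h1 : 1 - Real.exp (-x ^ 2 / 2) ≤ 1 := by linarith [Real.exp_pos (-x ^ 2 / 2)]
  have h2 : (√(2 * Real.pi))⁻¹ * (x ^ 2)⁻¹ ≤ 1 * (x ^ 2)⁻¹ := by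
    gcongr; exact inv_sqrt_two_pi_le_one
  calc _ ≤ (√(2 * Real.pi))⁻¹ * (x ^ 2)⁻¹ * 1 := by gcongr
    _ ≤ _ := by linarith

lemma g_le_half (x : ℝ) : g x ≤ 1 / 2 := by
  rcases eq_or_ne x 0 with rfl | hx
  · simp only [g, if_true]
    linarith [inv_sqrt_two_pi_le_one]
  · rw [g_of_ne hx]
    calc _ ≤ 1 * (x ^ 2)⁻¹ * (x ^ 2 / 2) := by
          have := one_sub_exp_le x
          have h3 : 0 ≤ 1 - Real.exp (-x ^ 2 / 2) := by
            rw [sub_nonneg, Real.exp_le_one_iff]; nlinarith [sq_nonneg x]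
          gcongr
          exact inv_sqrt_two_pi_le_one
      _ = 1 / 2 := by field_simp

lemma g_le (x : ℝ) : g x ≤ 3 / 2 * (1 + x ^ 2)⁻¹ := by
  rw [← div_eq_mul_inv, le_div_iff₀ (by positivity)]
  rcases eq_or_ne x 0 with rfl | hx
  · linarith [g_le_half 0]
  · have h1 := g_le_inv_sq x hx
    rw [← one_div, le_div_iff₀ (by positivity)] at h1
    linarith [g_le_half x]

lemma integrable_g : Integrable g := by
  refine (integrable_inv_one_add_sq.const_mul (3 / 2)).mono' measurable_g.aestronglyMeasurable
    (ae_of_all _ fun x => ?_)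
  rw [Real.norm_of_nonneg (g_pos x).le]
  exact g_le x

lemma mul_g_of_ne {x : ℝ} (hx : x ≠ 0) :
    x * g x = (√(2 * Real.pi))⁻¹ * ((1 - Real.exp (-x ^ 2 / 2)) / x) := by
  rw [g_of_ne hx]; field_simp

/-- This explicit antiderivative of `g - phi` yields both the normalisation of `g` and the exact
tail integral `a * g a` that becomes the Chernoff exponent for the weight. -/
lemma hasDerivAt_neg_mul_g {x : ℝ} (hx : x ≠ 0) :
    HasDerivAt (fun y => -(y * g y)) (g x - phi x) x := by
  have h1 : HasDerivAt (fun y : ℝ => -y ^ 2 / 2) (-x) x := by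
    have := ((hasDerivAt_pow 2 x).neg.div_const 2)
    refine this.congr_deriv ?_
    norm_num
    ring
  have h2 := (((h1.exp.const_sub 1).div (hasDerivAt_id x) hx).const_mul (√(2 * Real.pi))⁻¹).neg
  refine HasDerivAt.congr_of_eventuallyEq (h2.congr_deriv ?_) ?_
  · rw [g_of_ne hx, phi_eq]
    simp only [id]
    field_simp
    ring
  · filter_upwards [isOpen_ne.mem_nhds hx] with y hy
    simp only [mul_g_of_ne hy, Pi.neg_apply, Pi.div_apply, id]

lemma integral_Ioi_g_sub_phi {a : ℝ} (ha : 0 ≤ a) :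
    ∫ x in Set.Ioi a, (g x - phi x) = a * g a := by
  have hcont : ContinuousWithinAt (fun y => -(y * g y)) (Set.Ici a) a := by
    rcases eq_or_ne a 0 with rfl | h0
    · refine ContinuousAt.continuousWithinAt ?_
      have : Tendsto (fun y : ℝ => -(y * g y)) (𝓝 0) (𝓝 0) := by
        refine squeeze_zero_norm (a := fun y : ℝ => |y|) (fun y => ?_) ?_
        · rw [norm_neg, norm_mul, Real.norm_eq_abs, Real.norm_of_nonneg (g_pos y).le]
          nlinarith [abs_nonneg y, g_le_half y]
        · simpa using (continuous_abs.tendsto (0 : ℝ))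
      simpa [ContinuousAt] using this
    · exact (hasDerivAt_neg_mul_g h0).continuousAt.continuousWithinAt
  have hlim : Tendsto (fun y : ℝ => -(y * g y)) atTop (𝓝 0) := by
    refine squeeze_zero_norm' (a := fun y : ℝ => y⁻¹) ?_ tendsto_inv_atTop_zero
    filter_upwards [eventually_gt_atTop 0] with y hy
    rw [norm_neg, norm_mul, Real.norm_of_nonneg hy.le, Real.norm_of_nonneg (g_pos y).le]
    calc y * g y ≤ y * (y ^ 2)⁻¹ := by gcongr; exact g_le_inv_sq y hy.ne'
      _ = y⁻¹ := by field_simp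
  have := integral_Ioi_of_hasDerivAt_of_tendsto hcont
    (fun x hx => hasDerivAt_neg_mul_g (ha.trans_lt hx).ne')
    (integrable_g.sub integrable_phi).integrableOn hlim
  simpa using this

lemma integral_g_sub_phi : ∫ x, (g x - phi x) = 0 := by
  have h := integral_comp_abs (f := fun x => g x - phi x)
  simp only [g_abs, phi_abs] at h
  rw [h, integral_Ioi_g_sub_phi le_rfl]; simp

lemma integral_g : ∫ x, g x = 1 := by
  have := integral_g_sub_phi
  rw [integral_sub integrable_g integrable_phi, integral_phi] at this
  linarith

/-! ### Upper tails -/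

lemma upperTail_le_one_of {f : ℝ → ℝ} (hf : Integrable f) (h0 : ∀ x, 0 < f x)
    (h1 : ∫ x, f x = 1) (x : ℝ) : upperTail f x ≤ 1 :=
  h1 ▸ setIntegral_le_integral hf (ae_of_all _ fun x => (h0 x).le)

lemma upperTail_pos_of {f : ℝ → ℝ} (hf : Integrable f) (h0 : ∀ x, 0 < f x) (x : ℝ) :
    0 < upperTail f x := by
  rw [upperTail, setIntegral_pos_iff_support_of_nonneg_ae (ae_of_all _ fun x => (h0 x).le)
    hf.integrableOn]
  have : Function.support f = Set.univ := by
    ext y; simp [(h0 y).ne']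
  simp [this]

lemma upperTail_phi_pos (x : ℝ) : 0 < upperTail phi x := upperTail_pos_of integrable_phi phi_pos x

lemma upperTail_g_pos (x : ℝ) : 0 < upperTail g x := upperTail_pos_of integrable_g g_pos x

lemma upperTail_g_le_one (x : ℝ) : upperTail g x ≤ 1 :=
  upperTail_le_one_of integrable_g g_pos integral_g x

lemma upperTail_eq_add {f : ℝ → ℝ} (hf : Integrable f) {x y : ℝ} (h : x ≤ y) :
    upperTail f x = (∫ u in Set.Ioc x y, f u) + upperTail f y := by
  rw [upperTail, upperTail, ← setIntegral_union (Set.Ioc_disjoint_Ioi le_rfl) measurableSet_Ioi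
    hf.integrableOn hf.integrableOn, Set.Ioc_union_Ioi_eq_Ioi h]

lemma gaussianReal_Ioi (x : ℝ) :
    gaussianReal 0 1 (Set.Ioi x) = ENNReal.ofReal (upperTail phi x) :=
  gaussianReal_apply_eq_integral 0 one_ne_zero _

lemma mul_upperTail_g_le {x : ℝ} (hx : 0 < x) : x * upperTail g x ≤ 1 := by
  have h : upperTail g x ≤ ∫ u in Set.Ioi x, u ^ (-2 : ℝ) := by
    refine setIntegral_mono_on integrable_g.integrableOn
      (integrableOn_Ioi_rpow_of_lt (by norm_num) hx) measurableSet_Ioi fun u hu => ?_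
    have hu' : 0 < u := hx.trans hu
    rw [Real.rpow_neg hu'.le, Real.rpow_two]
    exact g_le_inv_sq u hu'.ne'
  rw [integral_Ioi_rpow_of_lt (by norm_num) hx] at h
  norm_num [Real.rpow_neg_one] at h
  calc x * upperTail g x ≤ x * x⁻¹ := by gcongr
    _ = 1 := mul_inv_cancel₀ hx.ne'

/-- Only the mass of `(x, x + d]` is kept, where `phi` is at least its value at the right end; `d`
is left free for tuning. -/
lemma mul_phi_le_upperTail {x d : ℝ} (hx : 0 ≤ x) (hd : 0 ≤ d) :
    d * phi (x + d) ≤ upperTail phi x := by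
  rw [upperTail_eq_add integrable_phi (le_add_of_nonneg_right hd : x ≤ x + d)]
  have h : ∫ u in Set.Ioc x (x + d), phi (x + d) ≤ ∫ u in Set.Ioc x (x + d), phi u := by
    refine setIntegral_mono_on (integrableOn_const (by simp) (by simp)) integrable_phi.integrableOn
      measurableSet_Ioc fun u hu => ?_
    rw [phi_eq, phi_eq]
    have : u ^ 2 ≤ (x + d) ^ 2 := by
      have := hu.1
      have := hu.2
      gcongr
      linarith
    gcongr
  simp only [setIntegral_const, smul_eq_mul, Measure.real, Real.volume_Ioc,
    add_sub_cancel_left, ENNReal.toReal_ofReal hd] at h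
  linarith [upperTail_phi_pos (x + d)]

lemma lratio_mul_upperTail_le {x : ℝ} (hx : 0 ≤ x) :
    lratio x * upperTail phi x ≤ upperTail g x := by
  rw [upperTail, upperTail, ← integral_const_mul]
  refine setIntegral_mono_on (integrable_phi.const_mul _).integrableOn integrable_g.integrableOn
    measurableSet_Ioi fun u hu => ?_
  rw [g_eq]
  have hu' : x < u := hu
  have := phi_pos u
  gcongr
  exact lratio_mono (by rw [abs_of_nonneg hx, abs_of_pos (hx.trans_lt hu')]; exact hu'.le)

/-- The ratio of the upper tails of `g` and `phi` is nondecreasing. -/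
lemma upperTail_mul_le {x y : ℝ} (hx : 0 ≤ x) (h : x ≤ y) :
    upperTail g x * upperTail phi y ≤ upperTail g y * upperTail phi x := by
  have h1 : ∫ u in Set.Ioc x y, g u ≤ lratio y * ∫ u in Set.Ioc x y, phi u := by
    rw [← integral_const_mul]
    refine setIntegral_mono_on integrable_g.integrableOn (integrable_phi.const_mul _).integrableOn
      measurableSet_Ioc fun u hu => ?_
    rw [g_eq]
    have := phi_pos u
    gcongr
    refine lratio_mono ?_
    rw [abs_of_pos (hx.trans_lt hu.1), abs_of_nonneg (hx.trans h)]
    exact hu.2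
  have h2 := lratio_mul_upperTail_le (hx.trans h)
  have h3 : 0 ≤ ∫ u in Set.Ioc x y, phi u := setIntegral_nonneg measurableSet_Ioc
    fun u _ => (phi_pos u).le
  rw [upperTail_eq_add integrable_g h, upperTail_eq_add integrable_phi h]
  have h4 := mul_le_mul_of_nonneg_right h1 (upperTail_phi_pos y).le
  have h5 := mul_le_mul_of_nonneg_right h2 h3
  nlinarith

lemma upperTail_phi_antitone : Antitone (upperTail phi) := fun x y h => by
  rw [upperTail_eq_add integrable_phi h]
  have h3 : 0 ≤ ∫ u in Set.Ioc x y, phi u := setIntegral_nonneg measurableSet_Ioc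
    fun u _ => (phi_pos u).le
  linarith

lemma continuous_upperTail_phi : Continuous (upperTail phi) := by
  have h : upperTail phi = fun x => (∫ u in Set.Ioi 0, phi u) - ∫ u in (0 : ℝ)..x, phi u := by
    ext x
    have := intervalIntegral.integral_interval_add_Ioi (a := 0) (b := x)
      integrable_phi.integrableOn integrable_phi.integrableOn
    rw [upperTail]
    linarith
  rw [h]
  exact continuous_const.sub
    (intervalIntegral.continuous_primitive (fun a b => integrable_phi.intervalIntegrable) 0)

/-! ### Monotonicity and comparison of `ℓ`- and `q`-values -/

lemma mix_pos {w p q : ℝ} (hw : w ∈ Set.Ioc (0 : ℝ) 1) (hp : 0 < p) (hq : 0 < q) :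
    0 < (1 - w) * p + w * q := by
  have h1 := mul_pos hw.1 hq
  have h2 := mul_nonneg (sub_nonneg.2 hw.2) hp.le
  linarith

lemma mix_ratio_le {w p q p' q' : ℝ} (hw : w ∈ Set.Ioc (0 : ℝ) 1) (hp : 0 < p) (hq : 0 < q)
    (hp' : 0 < p') (hq' : 0 < q') (h : p * q' ≤ q * p') :
    (1 - w) * p / ((1 - w) * p + w * q) ≤ (1 - w) * p' / ((1 - w) * p' + w * q') := by
  rw [div_le_div_iff₀ (mix_pos hw hp hq) (mix_pos hw hp' hq')]
  have := mul_le_mul_of_nonneg_left h (mul_nonneg (sub_nonneg.2 hw.2) hw.1.le)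
  nlinarith

lemma lval_nonneg {w : ℝ} (hw : w ∈ Set.Ioc (0 : ℝ) 1) (x : ℝ) : 0 ≤ lval x w :=
  div_nonneg (mul_nonneg (sub_nonneg.2 hw.2) (phi_pos x).le) (mix_pos hw (phi_pos x) (g_pos x)).le

lemma lval_antitone {w x y : ℝ} (hw : w ∈ Set.Ioc (0 : ℝ) 1) (h : |x| ≤ |y|) :
    lval y w ≤ lval x w := by
  refine mix_ratio_le hw (phi_pos y) (g_pos y) (phi_pos x) (g_pos x) ?_
  rw [g_eq x, g_eq y]
  have := mul_le_mul_of_nonneg_right (lratio_mono h) (mul_pos (phi_pos x) (phi_pos y)).le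
  linarith

lemma qval_antitone {w x y : ℝ} (hw : w ∈ Set.Ioc (0 : ℝ) 1) (h : |x| ≤ |y|) :
    qval y w ≤ qval x w := by
  refine mix_ratio_le hw (upperTail_phi_pos _) (upperTail_g_pos _) (upperTail_phi_pos _)
    (upperTail_g_pos _) ?_
  rw [mul_comm]
  exact upperTail_mul_le (abs_nonneg x) h

lemma qval_le_lval {w : ℝ} (hw : w ∈ Set.Ioc (0 : ℝ) 1) (x : ℝ) : qval x w ≤ lval x w := by
  refine mix_ratio_le hw (upperTail_phi_pos _) (upperTail_g_pos _) (phi_pos x) (g_pos x) ?_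
  rw [g_eq x]
  have := mul_le_mul_of_nonneg_right (lratio_mul_upperTail_le (abs_nonneg x)) (phi_pos x).le
  rw [lratio_abs] at this
  linarith

lemma upperTail_phi_lt_of_qval_lt {w c x : ℝ} (hw : w ∈ Set.Ioc (0 : ℝ) 1) (h : qval x w < c) :
    (1 - c) * (1 - w) * upperTail phi |x| < c * w * upperTail g |x| := by
  rw [qval, div_lt_iff₀ (mix_pos hw (upperTail_phi_pos _) (upperTail_g_pos _))] at h
  linarith

/-! ### Chernoff bounds and the weight estimator -/

instance {n : ℕ} (θ : Fin n → ℝ) : IsProbabilityMeasure (law θ) := by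
  unfold law; infer_instance

/-- A Chernoff bound, uniform over the values of the signals. -/
lemma law_sum_ge_le {n : ℕ} (θ : Fin n → ℝ) {h : ℝ → ℝ} (hm : Measurable h) {M κ : ℝ} (c : ℝ)
    (hM : ∀ x, h x ≤ M) (hκ : ∫ x, Real.exp (h x) ∂(gaussianReal 0 1) ≤ Real.exp κ) :
    law θ {X | c ≤ ∑ i, h (X i)} ≤
      ENNReal.ofReal (Real.exp ((supp θ).card * M + (n - (supp θ).card) * κ - c)) := by
  have hint : ∀ μ, Integrable (fun x => Real.exp (h x)) (gaussianReal μ 1) := fun μ =>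
    Integrable.of_bound (by fun_prop) (Real.exp M) (ae_of_all _ fun x => by
      rw [Real.norm_of_nonneg (Real.exp_pos _).le]
      exact Real.exp_le_exp.2 (hM x))
  have h1 := mul_meas_ge_le_integral_of_nonneg (μ := law θ)
    (f := fun X => ∏ i, Real.exp (h (X i)))
    (ae_of_all _ fun X => Finset.prod_nonneg fun i _ => (Real.exp_pos _).le)
    (Integrable.fintype_prod fun i => hint (θ i)) (Real.exp c)
  have h0 : ∫ X, ∏ i, Real.exp (h (X i)) ∂(law θ)
      = ∏ i, ∫ x, Real.exp (h x) ∂(gaussianReal (θ i) 1) :=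
    integral_fintype_prod_eq_prod (μ := fun i => gaussianReal (θ i) 1) fun _ x => Real.exp (h x)
  rw [h0] at h1
  simp only [← Real.exp_sum, Real.exp_le_exp] at h1
  have h2 : ∏ i, ∫ x, Real.exp (h x) ∂(gaussianReal (θ i) 1) ≤
      Real.exp ((supp θ).card * M + (n - (supp θ).card) * κ) := by
    calc _ ≤ ∏ i, Real.exp (if θ i ≠ 0 then M else κ) := by
          refine Finset.prod_le_prod (fun i _ => integral_nonneg fun x => (Real.exp_pos _).le)
            fun i _ => ?_
          split_ifs with hi
          · calc _ ≤ ∫ x, Real.exp M ∂(gaussianReal (θ i) 1) :=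
                  integral_mono (hint _) (integrable_const _) fun x => Real.exp_le_exp.2 (hM x)
              _ = _ := by simp
          · rw [not_not.1 hi]; exact hκ
      _ = _ := by
          have h3 := Finset.card_filter_add_card_filter_not (s := (Finset.univ : Finset (Fin n)))
            (fun i => θ i ≠ 0)
          rw [Finset.card_fin, ← supp] at h3
          have h4 : (((Finset.univ.filter fun i => ¬θ i ≠ 0).card : ℕ) : ℝ)
              = n - (supp θ).card := eq_sub_of_add_eq' (by exact_mod_cast h3)
          rw [← Real.exp_sum, Finset.sum_ite, Finset.sum_const, Finset.sum_const, nsmul_eq_mul,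
            nsmul_eq_mul, h4, supp]
  rw [← ENNReal.ofReal_toReal (measure_ne_top (law θ) _)]
  refine ENNReal.ofReal_le_ofReal ?_
  rw [Real.exp_sub, le_div_iff₀ (Real.exp_pos c), mul_comm]
  exact h1.trans h2

/-- The weighted and normalised score of one observation: the relative derivative of the marginal
density with respect to the weight. -/
noncomputable def score (w x : ℝ) : ℝ := w * (lratio x - 1) / (1 + w * (lratio x - 1))

lemma measurable_score (w : ℝ) : Measurable (score w) := by
  have := measurable_lratio
  unfold score
  fun_prop

lemma half_le_one_add {w : ℝ} (hw : w ∈ Set.Ioc (0 : ℝ) 1) (x : ℝ) :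
    1 / 2 ≤ 1 + w * (lratio x - 1) := by
  nlinarith [half_le_lratio x, hw.1, hw.2]

lemma mix_eq (w x : ℝ) : (1 - w) * phi x + w * g x = phi x * (1 + w * (lratio x - 1)) := by
  rw [g_eq]; ring

lemma wHat_mem_Ioc {n : ℕ} (hn : 0 < n) (X : Fin n → ℝ) : wHat X ∈ Set.Ioc (0 : ℝ) 1 :=
  ⟨lt_of_lt_of_le (by positivity) (wHat_mem X).1.1, (wHat_mem X).1.2⟩

/-- By `log y ≤ y - 1`, the gain in log-likelihood from `w` to `ŵ` is at most `(ŵ - w)/w` times the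
total score at `w`; maximality makes that gain nonnegative. -/
lemma sum_score_nonneg_of_lt_wHat {n : ℕ} (hn : 0 < n) (X : Fin n → ℝ) {w : ℝ} (hw : 1 / n ≤ w)
    (h : w < wHat X) : 0 ≤ ∑ i, score w (X i) := by
  have hv := wHat_mem_Ioc hn X
  have hw0 : 0 < w := lt_of_lt_of_le (by positivity) hw
  have hw' : w ∈ Set.Ioc (0 : ℝ) 1 := ⟨hw0, h.le.trans hv.2⟩
  have h1 : logLik X w ≤ logLik X (wHat X) := (wHat_mem X).2 ⟨hw, hw'.2⟩
  have h2 : logLik X (wHat X) - logLik X w ≤ (wHat X - w) / w * ∑ i, score w (X i) := by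
    rw [logLik, logLik, ← Finset.sum_sub_distrib, Finset.mul_sum]
    refine Finset.sum_le_sum fun i _ => ?_
    have p1 := mix_pos hv (phi_pos (X i)) (g_pos (X i))
    have p2 := mix_pos hw' (phi_pos (X i)) (g_pos (X i))
    rw [← Real.log_div p1.ne' p2.ne']
    refine (Real.log_le_sub_one_of_pos (div_pos p1 p2)).trans_eq ?_
    rw [mix_eq, mix_eq, score]
    have := half_le_one_add hw' (X i)
    have h3 : 1 + w * (lratio (X i) - 1) ≠ 0 := by positivity
    rw [mul_div_mul_left _ _ (phi_pos (X i)).ne', div_sub_one h3, div_mul_div_comm,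
      div_eq_div_iff h3 (mul_ne_zero hw0.ne' h3)]
    ring
  have h3 : 0 < (wHat X - w) / w := div_pos (sub_pos.2 h) hw0
  by_contra! hneg
  nlinarith [mul_pos h3 (neg_pos.2 hneg)]

lemma integral_gaussianReal_eq (f : ℝ → ℝ) :
    ∫ x, f x ∂(gaussianReal 0 1) = ∫ x, phi x * f x := by
  rw [integral_gaussianReal_eq_integral_smul one_ne_zero]; rfl

lemma integrable_gaussianReal_iff {f : ℝ → ℝ} :
    Integrable f (gaussianReal 0 1) ↔ Integrable fun x => phi x * f x := by
  rw [gaussianReal_of_var_ne_zero 0 one_ne_zero,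
    integrable_withDensity_iff_integrable_smul' (measurable_gaussianPDF 0 1)
      (ae_of_all _ fun x => gaussianPDF_lt_top)]
  simp [toReal_gaussianPDF, phi]

lemma integrable_lratio : Integrable (fun x => lratio x - 1) (gaussianReal 0 1) := by
  rw [integrable_gaussianReal_iff]
  refine (integrable_g.sub integrable_phi).congr (ae_of_all _ fun x => ?_)
  simp only [Pi.sub_apply, g_eq x]; ring

lemma integral_lratio : ∫ x, (lratio x - 1) ∂(gaussianReal 0 1) = 0 := by
  rw [integral_gaussianReal_eq, ← integral_g_sub_phi]
  congr 1; ext x; rw [g_eq x]; ring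

/-- With `z = w (lratio x - 1) ≥ -1/2`, the score is `y = z/(1+z) = z - z²/(1+z)`, it lies in `[-1,
1]`, and `y² ≤ 2 z²/(1+z)`. In `exp (y/4) ≤ 1 + y/4 + y²/16` the factor `1/4` lets the second-order
term consume only half of the gain `z²/(4(1+z))`. -/
lemma exp_score_le {w : ℝ} (hw : w ∈ Set.Ioc (0 : ℝ) 1) (x : ℝ) :
    Real.exp (score w x / 4) ≤ 1 + w / 4 * (lratio x - 1)
      - (w * (lratio x - 1)) ^ 2 / (1 + w * (lratio x - 1)) / 8 := by
  have h1 := half_le_one_add hw x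
  rw [score]
  set z := w * (lratio x - 1) with hz
  have hz1 : 0 < 1 + z := by linarith
  have hy1 : z / (1 + z) ≤ 1 := by rw [div_le_one hz1]; linarith
  have hy2 : -1 ≤ z / (1 + z) := by rw [le_div_iff₀ hz1]; linarith
  have h2 := (abs_le.1 (Real.abs_exp_sub_one_sub_id_le (x := z / (1 + z) / 4)
    (abs_le.2 ⟨by linarith, by linarith⟩))).2
  have h3 : z / (1 + z) = z - z ^ 2 / (1 + z) := by field_simp; ring
  have h4 : (z / (1 + z)) ^ 2 ≤ 2 * (z ^ 2 / (1 + z)) := by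
    rw [div_pow, ← mul_div_assoc, div_le_div_iff₀ (by positivity) hz1]
    nlinarith [mul_nonneg (mul_nonneg (sq_nonneg z) hz1.le) (by linarith : 0 ≤ 1 + 2 * z)]
  have h5 : w / 4 * (lratio x - 1) = z / 4 := by rw [hz]; ring
  rw [h5]
  nlinarith

/-- The linear term of `exp_score_le` has null mean zero. The quadratic gain is kept only beyond
`T`, where `z ≥ 1` gives `z²/(1+z) ≥ z/2`, and `z` integrates there to `w * (T * g T)`. -/
lemma integral_exp_score_le {w T : ℝ} (hw : w ∈ Set.Ioc (0 : ℝ) 1) (hT : 0 ≤ T)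
    (h : 1 ≤ w * (lratio T - 1)) :
    ∫ x, Real.exp (score w x / 4) ∂(gaussianReal 0 1) ≤ Real.exp (-(w / 16 * (T * g T))) := by
  have hdom : ∀ x, Real.exp (score w x / 4) ≤ 1 + w / 4 * (lratio x - 1)
      - (Set.Ioi T).indicator (fun x => w / 16 * (lratio x - 1)) x := by
    intro x
    refine (exp_score_le hw x).trans ?_
    have h1 := half_le_one_add hw x
    have hnn : 0 ≤ (w * (lratio x - 1)) ^ 2 / (1 + w * (lratio x - 1)) := by positivity
    by_cases hx : x ∈ Set.Ioi T
    · rw [Set.indicator_of_mem hx]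
      have h2 : lratio T ≤ lratio x := lratio_mono (by
        have hx' : T < x := hx
        rw [abs_of_nonneg hT, abs_of_pos (hT.trans_lt hx')]; exact hx'.le)
      have h3 := h.trans (mul_le_mul_of_nonneg_left (sub_le_sub_right h2 1) hw.1.le)
      set z := w * (lratio x - 1) with hz
      have h4 : w / 16 * (lratio x - 1) = z / 16 := by rw [hz]; ring
      have h5 : z / 2 ≤ z ^ 2 / (1 + z) := by
        rw [div_le_div_iff₀ (by norm_num) (by linarith)]; nlinarith
      rw [h4]; linarith
    · rw [Set.indicator_of_notMem hx]; linarith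
  have hi1 : Integrable (fun x => 1 + w / 4 * (lratio x - 1)) (gaussianReal 0 1) :=
    (integrable_const 1).add (integrable_lratio.const_mul _)
  have hi2 : Integrable ((Set.Ioi T).indicator (fun x => w / 16 * (lratio x - 1)))
      (gaussianReal 0 1) := (integrable_lratio.const_mul _).indicator measurableSet_Ioi
  have hms := measurable_score w
  have hint : Integrable (fun x => Real.exp (score w x / 4)) (gaussianReal 0 1) :=
    (hi1.sub hi2).mono' (by fun_prop) (ae_of_all _ fun x => by
      rw [Real.norm_of_nonneg (Real.exp_pos _).le]; exact hdom x)
  have hval : ∫ x, (Set.Ioi T).indicator (fun x => w / 16 * (lratio x - 1)) x ∂(gaussianReal 0 1)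
      = w / 16 * (T * g T) := by
    rw [integral_gaussianReal_eq, ← integral_Ioi_g_sub_phi hT, ← integral_const_mul,
      ← integral_indicator measurableSet_Ioi]
    congr 1; ext x
    by_cases hx : x ∈ Set.Ioi T
    · rw [Set.indicator_of_mem hx, Set.indicator_of_mem hx, g_eq x]; ring
    · rw [Set.indicator_of_notMem hx, Set.indicator_of_notMem hx, mul_zero]
  calc _ ≤ ∫ x, (1 + w / 4 * (lratio x - 1)
        - (Set.Ioi T).indicator (fun x => w / 16 * (lratio x - 1)) x) ∂(gaussianReal 0 1) :=
        integral_mono hint (hi1.sub hi2) hdom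
    _ = 1 - w / 16 * (T * g T) := by
        rw [integral_sub hi1 hi2, hval, integral_add (integrable_const 1)
          (integrable_lratio.const_mul _), integral_const_mul, integral_lratio]
        simp
    _ ≤ _ := by
        have := Real.add_one_le_exp (-(w / 16 * (T * g T)))
        linarith

lemma score_le_one {w : ℝ} (hw : w ∈ Set.Ioc (0 : ℝ) 1) (x : ℝ) : score w x ≤ 1 := by
  have h1 := half_le_one_add hw x
  rw [score, div_le_one (by linarith)]; linarith

/-- The weight estimator exceeds `w` with exponentially small probability. -/
lemma law_lt_wHat_le {n : ℕ} (hn : 0 < n) (θ : Fin n → ℝ) {w T : ℝ} (hw : 1 / n ≤ w) (hw1 : w ≤ 1)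
    (hT : 0 ≤ T) (h : 1 ≤ w * (lratio T - 1)) :
    law θ {X | w < wHat X} ≤ ENNReal.ofReal (Real.exp
      ((supp θ).card / 4 - (n - (supp θ).card) * (w / 16 * (T * g T)))) := by
  have hw' : w ∈ Set.Ioc (0 : ℝ) 1 := ⟨lt_of_lt_of_le (by positivity) hw, hw1⟩
  have h1 := law_sum_ge_le θ (h := fun x => score w x / 4) ((measurable_score w).div_const 4)
    (M := 1 / 4) 0 (fun x => by linarith [score_le_one hw' x]) (integral_exp_score_le hw' hT h)
  refine (measure_mono fun X hX => ?_).trans (h1.trans_eq ?_)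
  · have := sum_score_nonneg_of_lt_wHat hn X hw hX
    rw [Set.mem_ofPred_eq, ← Finset.sum_div]
    positivity
  · congr 2; ring

/-! ### From `Cℓ`-values to `q`-values to tail probabilities -/

/-- The supremum defining `lamHat` is attained by an equivalent threshold. -/
lemma exists_lvalProc_lamHat_eq {n : ℕ} {t w : ℝ} (ht : 0 ≤ t) (hw : w ∈ Set.Ioc (0 : ℝ) 1)
    (X : Fin n → ℝ) : ∃ lam, postFDR w X (lvalProc n lam w X) ≤ t ∧
      lvalProc n (lamHat t w X) w X = lvalProc n lam w X := by
  set A := {lam | lam ∈ Set.Icc (0 : ℝ) 1 ∧ postFDR w X (lvalProc n lam w X) ≤ t} with hA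
  have h0 : (0 : ℝ) ∈ A := by
    refine ⟨by simp, ?_⟩
    have : lvalProc n 0 w X = ∅ := by
      ext i; simp [lvalProc, lval_nonneg hw]
    simpa [this, postFDR] using ht
  have hbdd : BddAbove A := ⟨1, fun v hv => hv.1.2⟩
  -- Only finitely many `ℓ`-values lie below the supremum, so some admissible threshold exceeds the
  -- largest of them.
  obtain ⟨lam, hlam, hmax⟩ : ∃ lam ∈ A, ∀ i ∈ lvalProc n (lamHat t w X) w X,
      lval (X i) w < lam := by
    rcases (lvalProc n (lamHat t w X) w X).eq_empty_or_nonempty with h | h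
    · exact ⟨0, h0, by simp [h]⟩
    · obtain ⟨j, hj, hjm⟩ := Finset.exists_max_image _ (fun i => lval (X i) w) h
      have hj' : lval (X j) w < sSup A := (Finset.mem_filter.1 hj).2
      obtain ⟨lam, hlam, hlt⟩ := exists_lt_of_lt_csSup ⟨0, h0⟩ hj'
      exact ⟨lam, hlam, fun i hi => (hjm i hi).trans_lt hlt⟩
  refine ⟨lam, hlam.2, ?_⟩
  ext i
  refine ⟨fun hi => Finset.mem_filter.2 ⟨Finset.mem_univ _, hmax i hi⟩, fun hi =>
    Finset.mem_filter.2 ⟨Finset.mem_univ _, (Finset.mem_filter.1 hi).2.trans_le ?_⟩⟩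
  exact le_csSup hbdd hlam

/-- A Markov-type count: the sum of `c - ℓ` over `R` is at least `(c - t)` times its size, while
only indices with `ℓ < c` contribute positively, each at most `c`. -/
lemma card_le_of_postFDR_le {n : ℕ} {t w c : ℝ} (hw : w ∈ Set.Ioc (0 : ℝ) 1) (hc : 0 ≤ c)
    (X : Fin n → ℝ) (R : Finset (Fin n)) (h : postFDR w X R ≤ t) :
    (c - t) * R.card ≤ c * (Finset.univ.filter fun i => lval (X i) w < c).card := by
  rcases R.eq_empty_or_nonempty with rfl | hR
  · simp only [Finset.card_empty, Nat.cast_zero, mul_zero]; positivity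
  have hcard : (1 : ℝ) ≤ R.card := by exact_mod_cast hR.card_pos
  rw [postFDR, max_eq_right hcard, div_le_iff₀ (by linarith)] at h
  have h1 : ∑ i ∈ R, (c - lval (X i) w) ≤
      ∑ i ∈ R.filter (fun i => lval (X i) w < c), c := by
    rw [Finset.sum_filter]
    refine Finset.sum_le_sum fun i _ => ?_
    split_ifs with hi
    · linarith [lval_nonneg hw (X i)]
    · linarith
  have h2 : ((R.filter fun i => lval (X i) w < c).card : ℝ) ≤
      (Finset.univ.filter fun i => lval (X i) w < c).card := by
    exact_mod_cast Finset.card_le_card (Finset.filter_subset_filter _ (Finset.subset_univ _))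
  rw [Finset.sum_sub_distrib, Finset.sum_const, Finset.sum_const, nsmul_eq_mul,
    nsmul_eq_mul] at h1
  nlinarith [mul_le_mul_of_nonneg_left h2 hc]

lemma card_clProc_le {n : ℕ} (hn : 0 < n) {t c : ℝ} (ht : 0 ≤ t) (htc : t < c) (X : Fin n → ℝ) :
    ((clProc t n X).card : ℝ) ≤
      c / (c - t) * (Finset.univ.filter fun i => qval (X i) (wHat X) < c).card := by
  have hw := wHat_mem_Ioc hn X
  obtain ⟨lam, hlam, he⟩ := exists_lvalProc_lamHat_eq ht hw X
  have h1 := card_le_of_postFDR_le hw (ht.trans htc.le) X _ hlam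
  rw [← he] at h1
  have h2 : ((Finset.univ.filter fun i => lval (X i) (wHat X) < c).card : ℝ) ≤
      (Finset.univ.filter fun i => qval (X i) (wHat X) < c).card := by
    exact_mod_cast Finset.card_le_card
      (Finset.monotone_filter_right _ fun i _ hi => (qval_le_lval hw _).trans_lt hi)
  have hct : 0 < c - t := sub_pos.2 htc
  rw [div_mul_eq_mul_div, le_div_iff₀ hct, mul_comm]
  exact h1.trans (mul_le_mul_of_nonneg_left h2 (ht.trans htc.le))

/-- A two-step bootstrap: bounding the slab tail by `1` already forces `|x| ≥ a/2`, and there the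
slab tail is at most `2/a`. This factor cancels the `a` in the bound on the weight. -/
lemma tail_le_of_qval_lt {n : ℕ} (hn : 0 < n) {X : Fin n → ℝ} {w c a x : ℝ} (hw0 : 0 ≤ w)
    (hw : w ≤ 1 / 2) (hX : wHat X ≤ w) (hc0 : 0 < c) (hc1 : c < 1) (ha : 0 < a)
    (h : 2 * c / (1 - c) * w < upperTail phi (a / 2)) (hx : qval x (wHat X) < c) :
    upperTail phi |x| ≤ 2 * c / (1 - c) * w * (2 / a) := by
  have h1 := upperTail_phi_lt_of_qval_lt (wHat_mem_Ioc hn X) hx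
  have hc : 0 < 1 - c := sub_pos.2 hc1
  have hG := upperTail_g_pos |x|
  have hP := upperTail_phi_pos |x|
  have h2 : upperTail phi |x| ≤ 2 * c / (1 - c) * w * upperTail g |x| := by
    rw [div_mul_eq_mul_div, div_mul_eq_mul_div, le_div_iff₀ hc]
    have e1 : c * wHat X * upperTail g |x| ≤ c * w * upperTail g |x| := by gcongr
    have e2 : (1 - c) * (1 / 2) * upperTail phi |x| ≤
        (1 - c) * (1 - wHat X) * upperTail phi |x| := by
      gcongr; linarith
    linarith
  have hk : 0 ≤ 2 * c / (1 - c) * w := by positivity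
  have hax : a / 2 ≤ |x| := by
    by_contra! hlt
    have h3 := upperTail_phi_antitone hlt.le
    have h4 := mul_le_mul_of_nonneg_left (upperTail_g_le_one |x|) hk
    linarith
  refine h2.trans (mul_le_mul_of_nonneg_left ?_ hk)
  have h5 := mul_upperTail_g_le (x := |x|) (by linarith)
  rw [le_div_iff₀ ha]
  have := mul_le_mul_of_nonneg_right hax hG.le
  linarith

/-! ### Counting small tails and large observations -/

/-- The two-sided `p`-value of a null observation is superuniform. -/
lemma gaussianReal_upperTail_abs_le (p : ℝ) (hp : 0 ≤ p) :
    gaussianReal 0 1 {x | upperTail phi |x| ≤ p} ≤ ENNReal.ofReal (2 * p) := by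
  set D := {x : ℝ | 0 ≤ x ∧ upperTail phi x ≤ p} with hD
  have hDc : IsClosed D := isClosed_Ici.inter
    (isClosed_Iic.preimage continuous_upperTail_phi)
  have h1 : gaussianReal 0 1 D ≤ ENNReal.ofReal p := by
    rcases D.eq_empty_or_nonempty with h | h
    · simp [h]
    · have hb : BddBelow D := ⟨0, fun x hx => hx.1⟩
      have hmem := hDc.csInf_mem h hb
      have := nullSingletonClass_gaussianReal (μ := 0) (v := 1) one_ne_zero
      calc _ ≤ gaussianReal 0 1 (Set.Ici (sInf D)) := measure_mono fun x hx => csInf_le hb hx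
        _ = ENNReal.ofReal (upperTail phi (sInf D)) := by
            rw [← measure_congr Ioi_ae_eq_Ici, gaussianReal_Ioi]
        _ ≤ _ := ENNReal.ofReal_le_ofReal hmem.2
  have h2 : gaussianReal 0 1 ((fun x => -x) ⁻¹' D) ≤ ENNReal.ofReal p := by
    rw [← Measure.map_apply measurable_neg hDc.measurableSet, gaussianReal_map_neg, neg_zero]
    exact h1
  calc _ ≤ gaussianReal 0 1 (D ∪ (fun x => -x) ⁻¹' D) := by
        refine measure_mono fun x hx => ?_
        have hx' : upperTail phi |x| ≤ p := hx
        rcases le_total 0 x with h | h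
        · exact Or.inl ⟨h, by rwa [abs_of_nonneg h] at hx'⟩
        · exact Or.inr ⟨neg_nonneg.2 h, by rwa [abs_of_nonpos h] at hx'⟩
    _ ≤ _ := measure_union_le _ _
    _ ≤ ENNReal.ofReal p + ENNReal.ofReal p := add_le_add h1 h2
    _ = _ := by rw [← ENNReal.ofReal_add hp hp, two_mul]

lemma sum_indicator_eq_card {n : ℕ} (X : Fin n → ℝ) (D : Set ℝ) [DecidablePred (· ∈ D)] (c : ℝ) :
    ∑ i, D.indicator (fun _ => c) (X i) = (Finset.univ.filter fun i => X i ∈ D).card * c := by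
  simp [Set.indicator_apply, Finset.sum_ite]

lemma integral_exp_indicator {D : Set ℝ} (hD : MeasurableSet D) (c : ℝ) :
    ∫ x, Real.exp (D.indicator (fun _ => c) x) ∂(gaussianReal 0 1)
      = 1 + (Real.exp c - 1) * (gaussianReal 0 1).real D := by
  have h : ∀ x, Real.exp (D.indicator (fun _ => c) x)
      = 1 + D.indicator (fun _ => Real.exp c - 1) x := fun x => by
    by_cases hx : x ∈ D <;> simp [hx]
  simp_rw [h]
  rw [integral_add (integrable_const 1) ((integrable_const _).indicator hD),
    integral_indicator_const _ hD]
  simp [mul_comm]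

lemma law_card_upperTail_ge_le {n : ℕ} (θ : Fin n → ℝ) {p : ℝ} (hp : 0 ≤ p) (c : ℝ) :
    law θ {X | c ≤ ((Finset.univ.filter fun i => upperTail phi |X i| ≤ p).card : ℝ)} ≤
      ENNReal.ofReal (Real.exp ((supp θ).card + n * (4 * p) - c)) := by
  classical
  set D : Set ℝ := {x | upperTail phi |x| ≤ p} with hDdef
  have hD : MeasurableSet D :=
    (isClosed_Iic.preimage (continuous_upperTail_phi.comp continuous_abs)).measurableSet
  have hγ : (gaussianReal 0 1).real D ≤ 2 * p :=
    ENNReal.toReal_le_of_le_ofReal (by positivity) (gaussianReal_upperTail_abs_le p hp)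
  have h1 : ∫ x, Real.exp (D.indicator (fun _ => (1 : ℝ)) x) ∂(gaussianReal 0 1)
      ≤ Real.exp (4 * p) := by
    rw [integral_exp_indicator hD]
    have h3 : Real.exp 1 - 1 ≤ 2 := by linarith [Real.exp_one_lt_d9]
    have h4 : (Real.exp 1 - 1) * (gaussianReal 0 1).real D ≤ 2 * (2 * p) :=
      mul_le_mul h3 hγ measureReal_nonneg (by norm_num)
    linarith [Real.add_one_le_exp (4 * p)]
  have h2 := law_sum_ge_le θ (measurable_const.indicator hD) (M := 1) c
    (fun x => Set.indicator_apply_le' (fun _ => by norm_num) (fun _ => by norm_num)) h1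
  simp only [sum_indicator_eq_card, mul_one] at h2
  refine (h2.trans (ENNReal.ofReal_le_ofReal (Real.exp_le_exp.2 ?_)))
  have : 0 ≤ ((supp θ).card : ℝ) * (4 * p) := by positivity
  linarith

/-- Chernoff with exponent `-1` per exceedance: signals can only lower the exponential moment, hence
`M = 0`. -/
lemma law_card_Ioi_le_le {n : ℕ} (θ : Fin n → ℝ) {x : ℝ} (c : ℝ) :
    law θ {X | ((Finset.univ.filter fun i => x < X i).card : ℝ) ≤ c} ≤
      ENNReal.ofReal (Real.exp (c - (n - (supp θ).card) * (upperTail phi x / 2))) := by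
  classical
  have hγ : (gaussianReal 0 1).real (Set.Ioi x) = upperTail phi x := by
    rw [Measure.real, gaussianReal_Ioi, ENNReal.toReal_ofReal (upperTail_phi_pos x).le]
  have h1 : ∫ y, Real.exp ((Set.Ioi x).indicator (fun _ => (-1 : ℝ)) y) ∂(gaussianReal 0 1)
      ≤ Real.exp (-(upperTail phi x / 2)) := by
    rw [integral_exp_indicator measurableSet_Ioi, hγ]
    have h3 : Real.exp (-1) - 1 ≤ -(1 / 2) := by linarith [Real.exp_neg_one_lt_half]
    have h4 := mul_le_mul_of_nonneg_right h3 (upperTail_phi_pos x).le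
    linarith [Real.add_one_le_exp (-(upperTail phi x / 2))]
  have h2 := law_sum_ge_le θ (measurable_const.indicator measurableSet_Ioi) (M := 0) (-c)
    (fun x => Set.indicator_apply_le' (fun _ => by norm_num) (fun _ => by norm_num)) h1
  simp only [sum_indicator_eq_card, mul_neg_one, neg_le_neg_iff, Set.mem_Ioi] at h2
  refine h2.trans_eq ?_
  congr 2
  ring

/-! ### The signal scale and its numerical estimates -/

/-- The signal strength `√(2 log (n / s))` at the detection boundary. -/
noncomputable def signalRate (s : ℕ → ℕ) (n : ℕ) : ℝ := √(2 * Real.log ((n : ℝ) / s n))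

lemma eventually_pos_sparsity {s : ℕ → ℕ} (hs : Tendsto s atTop atTop) :
    ∀ᶠ n in atTop, 0 < n ∧ 0 < s n :=
  (eventually_gt_atTop 0).and (hs.eventually_gt_atTop 0)

lemma tendsto_log_div {s : ℕ → ℕ} (hs : Tendsto s atTop atTop)
    (hsn : Tendsto (fun n : ℕ => (s n : ℝ) / (n : ℝ)) atTop (𝓝 0)) :
    Tendsto (fun n : ℕ => Real.log ((n : ℝ) / s n)) atTop atTop := by
  refine Real.tendsto_log_atTop.comp ?_
  have h : Tendsto (fun n : ℕ => (s n : ℝ) / (n : ℝ)) atTop (𝓝[>] 0) := by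
    refine tendsto_nhdsWithin_iff.2 ⟨hsn, ?_⟩
    filter_upwards [eventually_pos_sparsity hs] with n hn
    have h1 : (0 : ℝ) < n := by exact_mod_cast hn.1
    have h2 : (0 : ℝ) < s n := by exact_mod_cast hn.2
    exact div_pos h2 h1
  simpa only [Function.comp_def, inv_div] using tendsto_inv_nhdsGT_zero.comp h

lemma tendsto_signalRate {s : ℕ → ℕ} (hs : Tendsto s atTop atTop)
    (hsn : Tendsto (fun n : ℕ => (s n : ℝ) / (n : ℝ)) atTop (𝓝 0)) :
    Tendsto (signalRate s) atTop atTop :=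
  Real.tendsto_sqrt_atTop.comp ((tendsto_log_div hs hsn).const_mul_atTop two_pos)

lemma eventually_exp_signalRate {s : ℕ → ℕ} (hs : Tendsto s atTop atTop)
    (hsn : Tendsto (fun n : ℕ => (s n : ℝ) / (n : ℝ)) atTop (𝓝 0)) :
    ∀ᶠ n in atTop, Real.exp (-signalRate s n ^ 2 / 2) = (s n : ℝ) / n := by
  filter_upwards [(tendsto_log_div hs hsn).eventually_ge_atTop 0, eventually_pos_sparsity hs]
    with n h hn
  have h1 : (0 : ℝ) < n := by exact_mod_cast hn.1
  have h2 : (0 : ℝ) < s n := by exact_mod_cast hn.2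
  have h3 : -signalRate s n ^ 2 / 2 = Real.log ((s n : ℝ) / n) := by
    rw [signalRate, Real.sq_sqrt (by positivity), ← inv_div (n : ℝ), Real.log_inv]
    ring
  rw [h3, Real.exp_log (div_pos h2 h1)]

lemma eventually_two_mul_le {s : ℕ → ℕ}
    (hsn : Tendsto (fun n : ℕ => (s n : ℝ) / (n : ℝ)) atTop (𝓝 0)) :
    ∀ᶠ n : ℕ in atTop, 2 * (s n : ℝ) ≤ n := by
  filter_upwards [hsn.eventually_lt_const (show (0 : ℝ) < 1 / 2 by norm_num),
    eventually_gt_atTop 0] with n h hn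
  have h1 : (0 : ℝ) < n := by exact_mod_cast hn
  rw [div_lt_iff₀ h1] at h
  linarith

lemma tendsto_exp_neg_sparsity {s : ℕ → ℕ} (hs : Tendsto s atTop atTop) :
    Tendsto (fun n => ENNReal.ofReal (Real.exp (-(s n / 4 : ℝ)))) atTop (𝓝 0) := by
  rw [← ENNReal.ofReal_zero]
  refine ENNReal.tendsto_ofReal (Real.tendsto_exp_neg_atTop_nhds_zero.comp ?_)
  exact (tendsto_natCast_atTop_atTop.comp hs).atTop_div_const (by norm_num)

lemma eventually_mul_exp_neg_lt {c : ℝ} (hc : 0 < c) :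
    ∀ᶠ a : ℝ in atTop, a * Real.exp (-a / 4) < c := by
  have h := (Real.tendsto_pow_mul_exp_neg_atTop_nhds_zero 1).comp
    (tendsto_id.atTop_div_const (show (0 : ℝ) < 4 by norm_num))
  filter_upwards [h.eventually_lt_const (show (0 : ℝ) < c / 4 by positivity)] with a ha
  simp only [Function.comp_apply, id, pow_one, ← neg_div] at ha
  linarith

/-- Certifies `T = 2a` for the weight `192 a exp (-a²/2)`: the ratio at `2a` is about `exp
(2a²)/(4a²)`, far above the inverse weight. The constant is `16 * 12`, with `16` from
`integral_exp_score_le` and `12` from `one_le_mul_mul_g`. -/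
lemma one_le_mul_lratio {a : ℝ} (ha : 2 ≤ a) :
    1 ≤ 192 * a * Real.exp (-a ^ 2 / 2) * (lratio (2 * a) - 1) := by
  rw [lratio_of_ne (by positivity)]
  set E := Real.exp (a ^ 2 / 2) with hE
  have hEa : a ^ 2 / 2 + 1 ≤ E := Real.add_one_le_exp _
  have h3 : 3 ≤ E := by nlinarith
  have e1 : Real.exp (-a ^ 2 / 2) = E⁻¹ := by rw [hE, ← Real.exp_neg, neg_div]
  have e2 : Real.exp ((2 * a) ^ 2 / 2) = E ^ 4 := by
    rw [hE, ← Real.exp_nat_mul]; congr 1; push_cast; ring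
  rw [e1, e2]
  have hE0 : 0 < E := by linarith
  have h4 : (E ^ 3 - 1) / 8 ≤ (E ^ 4 - 1) / (2 * a) ^ 2 := by
    rw [div_le_div_iff₀ (by norm_num) (by positivity)]
    have : 0 ≤ E ^ 3 - 1 := by nlinarith [pow_le_pow_left₀ (by norm_num) h3 3]
    have h5 : (2 * a) ^ 2 ≤ 8 * E := by nlinarith
    have := mul_le_mul_of_nonneg_left h5 this
    nlinarith
  have h27 : 9 * E ≤ E ^ 3 := by nlinarith [pow_le_pow_left₀ (by norm_num) h3 2]
  have h6 : E / 192 ≤ (E ^ 4 - 1) / (2 * a) ^ 2 - 1 := by nlinarith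
  calc (1 : ℝ) ≤ a := by linarith
    _ = 192 * a * E⁻¹ * (E / 192) := by field_simp
    _ ≤ _ := by gcongr

lemma one_le_mul_mul_g {a : ℝ} (ha : 1 ≤ a) : 1 ≤ 12 * a * (2 * a * g (2 * a)) := by
  have h0 : 2 * a ≠ 0 := by positivity
  rw [mul_g_of_ne h0]
  have h1 : Real.exp (-(2 * a) ^ 2 / 2) ≤ 1 / 2 := by
    have : Real.exp (-(2 * a) ^ 2 / 2) ≤ Real.exp (-1) := Real.exp_le_exp.2 (by nlinarith)
    linarith [Real.exp_neg_one_lt_half]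
  calc (1 : ℝ) = 12 * a * (1 / 3 * ((1 - 1 / 2) / (2 * a))) := by field_simp; norm_num
    _ ≤ _ := by
      gcongr
      exact third_le_inv_sqrt_two_pi

lemma exp_le_upperTail_half {a : ℝ} (ha : 4 ≤ a) :
    1 / 3 * (Real.exp (-a ^ 2 / 2) * Real.exp (a / 4)) ≤ upperTail phi (a / 2) := by
  have h := mul_phi_le_upperTail (x := a / 2) (d := 1) (by positivity) zero_le_one
  rw [one_mul, phi_eq] at h
  refine le_trans ?_ h
  rw [← Real.exp_add]
  refine mul_le_mul third_le_inv_sqrt_two_pi (Real.exp_le_exp.2 ?_) (Real.exp_pos _).le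
    inv_sqrt_two_pi_pos.le
  nlinarith

/-- Deterministic conditions on the signal strength `a`, with `s = n exp (-a² / 2)`, under which
the number of small `q`-values is of the order of `s`. -/
lemma law_card_qval_ge_le {n : ℕ} (hn : 0 < n) (θ : Fin n → ℝ) {a c x : ℝ} (ha : 4 ≤ a)
    (hs : 0 < (supp θ).card) (hsn : 2 * ((supp θ).card : ℝ) ≤ n)
    (hexp : Real.exp (-a ^ 2 / 2) = ((supp θ).card : ℝ) / n)
    (ha1 : a * Real.exp (-a / 4) < 1 / 384) (hc0 : 0 < c) (hc1 : c < 1)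
    (ha2 : a * Real.exp (-a / 4) < (1 - c) / (1152 * c)) :
    law θ {X | x ≤ ((Finset.univ.filter fun i => qval (X i) (wHat X) < c).card : ℝ)} ≤
      ENNReal.ofReal (Real.exp (-((supp θ).card / 4))) + ENNReal.ofReal (Real.exp
        ((1 + 3072 * c / (1 - c)) * (supp θ).card - x)) := by
  set S : ℝ := ((supp θ).card : ℝ) with hS
  have hn' : (0 : ℝ) < n := by exact_mod_cast hn
  have hS1 : 1 ≤ S := by rw [hS]; exact_mod_cast hs
  have hc : 0 < 1 - c := sub_pos.2 hc1
  set w := 192 * a * Real.exp (-a ^ 2 / 2) with hw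
  have ha0 : 0 < a := by linarith
  have hle : Real.exp (-a ^ 2 / 2) ≤ Real.exp (-a / 4) := Real.exp_le_exp.2 (by nlinarith)
  have hw2 : w ≤ 1 / 2 := by
    have := mul_le_mul_of_nonneg_left hle ha0.le
    rw [hw]; linarith
  have hwn : 1 / n ≤ w := by
    rw [hw, hexp, ← mul_div_assoc]
    gcongr
    nlinarith
  have hw0 : 0 ≤ w := by positivity
  have b1 : law θ {X | w < wHat X} ≤ ENNReal.ofReal (Real.exp (-(S / 4))) := by
    refine (law_lt_wHat_le hn θ hwn (by linarith) (by positivity : 0 ≤ 2 * a)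
      (one_le_mul_lratio (by linarith))).trans (ENNReal.ofReal_le_ofReal (Real.exp_le_exp.2 ?_))
    rw [← hS]
    -- The drift per null is at least `S/n`, and `n - S ≥ n/2`, so the total exponent is at most
    -- `S/4 - S/2`.
    have h1 : S / n ≤ w / 16 * (2 * a * g (2 * a)) := by
      have := mul_le_mul_of_nonneg_left (one_le_mul_mul_g (by linarith : 1 ≤ a))
        (by positivity : 0 ≤ S / n)
      rw [hw, hexp]; linarith
    have h2 : S / 2 ≤ (n - S) * (S / n) := by
      rw [mul_div_assoc', div_le_div_iff₀ two_pos hn']; nlinarith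
    have := mul_le_mul_of_nonneg_left h1 (by linarith : 0 ≤ n - S)
    linarith
  have hq : 2 * c / (1 - c) * w < upperTail phi (a / 2) := by
    refine lt_of_lt_of_le ?_ (exp_le_upperTail_half ha)
    -- `1152 = 3 * 2 * 192`; the factor `exp (a/4)` in the tail at `a/2` beats the linear factor `a`
    -- in `w`.
    have h1 : 1152 * c / (1 - c) * (a * Real.exp (-a / 4)) < 1 := by
      rw [lt_div_iff₀ (by positivity)] at ha2
      rw [div_mul_eq_mul_div, div_lt_one hc]; linarith
    have h2 : Real.exp (-a / 4) * Real.exp (a / 4) = 1 := by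
      rw [← Real.exp_add]; simp [neg_div]
    have h3 : 0 < Real.exp (-a ^ 2 / 2) * Real.exp (a / 4) := by positivity
    have h4 := mul_lt_mul_of_pos_right h1 h3
    have h5 : 1152 * c / (1 - c) * (a * Real.exp (-a / 4)) * (Real.exp (-a ^ 2 / 2) *
        Real.exp (a / 4)) = 3 * (2 * c / (1 - c) * w) := by
      rw [hw]
      linear_combination (1152 * c / (1 - c) * a * Real.exp (-a ^ 2 / 2)) * h2
    linarith
  set p := 2 * c / (1 - c) * w * (2 / a) with hp
  have hp0 : 0 ≤ p := by positivity
  -- `3072 = 4 * 2 * 192 * 2`, and the powers of `a` cancel.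
  have hnp : n * (4 * p) = 3072 * c / (1 - c) * S := by
    rw [hp, hw, hexp]; field_simp; ring
  have b2 := law_card_upperTail_ge_le θ hp0 x
  rw [hnp] at b2
  calc _ ≤ law θ ({X | w < wHat X} ∪
        {X | x ≤ ((Finset.univ.filter fun i => upperTail phi |X i| ≤ p).card : ℝ)}) := by
        refine measure_mono fun X hX => ?_
        by_cases h : w < wHat X
        · exact Or.inl h
        · refine Or.inr (le_trans (show x ≤ _ from hX) ?_)
          exact_mod_cast Finset.card_le_card (Finset.monotone_filter_right _ fun i _ hi =>
            tail_le_of_qval_lt hn hw0 hw2 (not_lt.1 h) hc0 hc1 ha0 hq hi)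
    _ ≤ _ := measure_union_le _ _
    _ ≤ _ := by
        refine add_le_add b1 (b2.trans_eq ?_)
        congr 2; rw [← hS]; ring

/-! ### Sparsity preservation -/

theorem sparsityPreserving_of_card_le {φ : ∀ n, Procedure n} {c C : ℝ} (hc0 : 0 < c) (hc1 : c < 1)
    (hC : 0 < C) (hφ : ∀ n, 0 < n → ∀ X, ((φ n X).card : ℝ) ≤
      C * (Finset.univ.filter fun i => qval (X i) (wHat X) < c).card)
    {s : ℕ → ℕ} (hs : Tendsto s atTop atTop)
    (hsn : Tendsto (fun n : ℕ => (s n : ℝ) / (n : ℝ)) atTop (𝓝 0))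
    {A : ℕ → ℝ} (hA : Tendsto A atTop atTop) (b : ℝ) :
    SparsityPreserving φ s A (fun n => signalClass n (s n) b) := by
  have hlim := (tendsto_exp_neg_sparsity hs).add (tendsto_exp_neg_sparsity hs)
  rw [add_zero] at hlim
  have hc : 0 < 1 - c := sub_pos.2 hc1
  refine tendsto_of_tendsto_of_tendsto_of_le_of_le' tendsto_const_nhds hlim
    (Eventually.of_forall fun _ => zero_le) ?_
  have hr := tendsto_signalRate hs hsn
  filter_upwards [eventually_pos_sparsity hs, hr.eventually_ge_atTop 4,
    eventually_exp_signalRate hs hsn, eventually_two_mul_le hsn,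
    hr.eventually (eventually_mul_exp_neg_lt (show (0 : ℝ) < 1 / 384 by norm_num)),
    hr.eventually (eventually_mul_exp_neg_lt (show 0 < (1 - c) / (1152 * c) by positivity)),
    hA.eventually_ge_atTop (C * (2 + 3072 * c / (1 - c)))] with n hn h1 h2 h3 h4 h5 h6
  refine iSup₂_le fun θ hθ => ?_
  obtain ⟨hcard, -⟩ := hθ
  refine le_trans (measure_mono fun X hX => ?_) ((law_card_qval_ge_le hn.1 θ
    (x := A n / C * s n) h1 (hcard ▸ hn.2) (hcard ▸ h3) (hcard ▸ h2) h4 hc0 hc1 h5).trans ?_)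
  · have hX' : A n * s n < (φ n X).card := hX
    have := hX'.le.trans (hφ n hn.1 X)
    rw [Set.mem_ofPred_eq, div_mul_eq_mul_div, div_le_iff₀ hC]
    linarith
  · rw [hcard]
    refine add_le_add le_rfl (ENNReal.ofReal_le_ofReal (Real.exp_le_exp.2 ?_))
    -- This leaves an exponent of at most `-s`, below the `-s/4` of the weight event.
    have h7 : 2 + 3072 * c / (1 - c) ≤ A n / C := by
      rw [le_div_iff₀ hC]; linarith
    have h8 : (0 : ℝ) ≤ s n := Nat.cast_nonneg _
    have := mul_le_mul_of_nonneg_right h7 h8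
    linarith

/-! ### Lower bound on the false negative rate -/

/-- Truncation leaves room at both ends: `1/(k+1)` is the slack `ε` in the threshold, and the bound
`-k` keeps the shifted interval inside the two-sided acceptance region. -/
lemma exists_lt_gaussianReal_Icc {b : ℝ} {c : ℝ≥0∞} (h : c < gaussianReal 0 1 (Set.Ioi b)) :
    ∃ k : ℕ, c < gaussianReal 0 1 (Set.Icc (-(k : ℝ)) (-b - 1 / (k + 1))) := by
  have h1 : gaussianReal 0 1 (Set.Ioi b) = gaussianReal 0 1 (Set.Iio (-b)) := by
    nth_rw 1 [← neg_zero, ← gaussianReal_map_neg]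
    rw [Measure.map_apply measurable_neg measurableSet_Ioi]
    congr 1
    ext x
    simp only [Set.mem_preimage, Set.mem_Ioi, Set.mem_Iio]
    exact lt_neg
  have hmono : Monotone fun k : ℕ => Set.Icc (-(k : ℝ)) (-b - 1 / (k + 1)) := fun k l hkl => by
    have : (k : ℝ) ≤ l := by exact_mod_cast hkl
    refine Set.Icc_subset_Icc (by linarith) ?_
    gcongr
  have hU : ⋃ k : ℕ, Set.Icc (-(k : ℝ)) (-b - 1 / (k + 1)) = Set.Iio (-b) := by
    ext x
    simp only [Set.mem_iUnion, Set.mem_Icc, Set.mem_Iio]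
    constructor
    · rintro ⟨k, -, hk⟩
      have : (0 : ℝ) < 1 / (k + 1) := by positivity
      linarith
    · intro hx
      obtain ⟨k, hk⟩ := exists_nat_one_div_lt (sub_pos.2 hx)
      obtain ⟨l, hl⟩ := exists_nat_ge (-x)
      refine ⟨max k l, ?_, ?_⟩
      · have : (l : ℝ) ≤ (max k l : ℕ) := by exact_mod_cast le_max_right k l
        linarith
      · have h2 : (k : ℝ) ≤ (max k l : ℕ) := by exact_mod_cast le_max_left k l
        have : (1 : ℝ) / ((max k l : ℕ) + 1) ≤ 1 / (k + 1) := by gcongr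
        linarith
  have hlim := tendsto_measure_iUnion_atTop (μ := gaussianReal 0 1) hmono
  rw [hU, ← h1] at hlim
  exact (hlim.eventually_const_lt h).exists

lemma gaussianReal_Icc_add (m x y : ℝ) :
    gaussianReal m 1 (Set.Icc (m + x) (m + y)) = gaussianReal 0 1 (Set.Icc x y) := by
  have h := gaussianReal_map_const_add (μ := 0) (v := 1) m
  rw [zero_add] at h
  rw [← h, Measure.map_apply (by fun_prop) measurableSet_Icc]
  congr 1
  ext z
  simp

lemma le_FNR_add {n : ℕ} (φ : Procedure n) (θ : Fin n → ℝ) {τ : ℝ} {v : ℝ≥0∞}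
    (hS : 0 < (supp θ).card) (hv : ∀ i ∈ supp θ, v ≤ gaussianReal (θ i) 1 (Set.Icc (-τ) τ))
    {B : Set (Fin n → ℝ)} (hB : ∀ X ∉ B, ∀ i ∈ φ X, τ < |X i|) :
    v ≤ FNR φ θ + law θ B := by
  classical
  set I := Set.Icc (-τ) τ with hI
  have hS1 : (1 : ℝ≥0∞) ≤ ((supp θ).card : ℝ≥0∞) := by exact_mod_cast hS
  have hS0 : ((supp θ).card : ℝ≥0∞) ≠ 0 := (zero_lt_one.trans_le hS1).ne'
  have hmI : Measurable (I.indicator fun _ => (1 : ℝ≥0∞)) :=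
    measurable_const.indicator measurableSet_Icc
  have h1 : v ≤ ∫⁻ X, (∑ i ∈ supp θ, I.indicator (fun _ => 1) (X i)) / ((supp θ).card : ℝ≥0∞)
      ∂(law θ) := by
    simp_rw [div_eq_mul_inv]
    rw [lintegral_mul_const _ (by fun_prop), lintegral_finsetSum _ (fun i _ => by fun_prop),
      ← div_eq_mul_inv, ENNReal.le_div_iff_mul_le (Or.inl hS0) (Or.inl (by simp)), mul_comm,
      ← nsmul_eq_mul]
    refine Finset.card_nsmul_le_sum _ _ _ fun i hi => (hv i hi).trans_eq ?_
    exact (((measurePreserving_eval (fun i => gaussianReal (θ i) 1) i).lintegral_comp hmI).trans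
      (lintegral_indicator_one measurableSet_Icc)).symm
  have h2 : ∀ X, (∑ i ∈ supp θ, I.indicator (fun _ => (1 : ℝ≥0∞)) (X i)) /
      ((supp θ).card : ℝ≥0∞) ≤ ((supp θ \ φ X).card : ℝ≥0∞) / max 1 ((supp θ).card : ℝ≥0∞)
        -- The measurable hull spares any measurability of the procedure or of `B`.
        + (toMeasurable (law θ) B).indicator (fun _ => 1) X := by
    intro X
    have hsum : ∑ i ∈ supp θ, I.indicator (fun _ => (1 : ℝ≥0∞)) (X i)
        = (((supp θ).filter fun i => X i ∈ I).card : ℝ≥0∞) := by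
      rw [← Finset.sum_boole]
      simp only [Set.indicator_apply]
    rw [hsum, max_eq_right hS1]
    by_cases hX : X ∈ B
    · rw [Set.indicator_of_mem (subset_toMeasurable _ _ hX)]
      refine le_add_left (ENNReal.div_le_of_le_mul ?_)
      rw [one_mul]
      exact_mod_cast Finset.card_filter_le _ _
    · refine le_add_right (ENNReal.div_le_div_right ?_ _)
      refine Nat.cast_le.2 (Finset.card_le_card fun i hi => ?_)
      rw [Finset.mem_filter] at hi
      refine Finset.mem_sdiff.2 ⟨hi.1, fun hφ => ?_⟩
      exact absurd (hB X hX i hφ) (not_lt.2 (abs_le.2 hi.2))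
  calc v ≤ _ := h1
    _ ≤ _ := lintegral_mono h2
    _ = _ := by
      rw [lintegral_add_right _ (measurable_const.indicator (measurableSet_toMeasurable _ _)),
        lintegral_indicator_const (measurableSet_toMeasurable _ _), one_mul, measure_toMeasurable,
        FNR]

lemma exists_mem_signalClass {n s : ℕ} (hsn : s ≤ n) {b : ℝ}
    (hb : 0 < √(2 * Real.log ((n : ℝ) / s)) + b) :
    ∃ θ ∈ signalClass n s b, ∀ i ∈ supp θ, θ i = √(2 * Real.log ((n : ℝ) / s)) + b := by
  obtain ⟨T, -, hT⟩ := Finset.exists_subset_card_eq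
    (s := (Finset.univ : Finset (Fin n))) (n := s) (by simpa using hsn)
  set v := √(2 * Real.log ((n : ℝ) / s)) + b with hv
  have hsupp : supp (fun i => if i ∈ T then v else 0) = T := by
    ext i; simp [supp, hb.ne']
  refine ⟨fun i => if i ∈ T then v else 0, ⟨by rw [hsupp, hT], fun i hi => ?_⟩, fun i hi => ?_⟩
  · rw [hsupp] at hi
    simp only [hi, if_true]
    exact le_abs_self v
  · rw [hsupp] at hi
    simp [hi]

/-- Half of `ε` is the integration width; the other half gains a factor `exp (a ε/4)` or more,
bounded below by `(a ε/4)²/2`. The product of constants is `ε³ a²/192`, and `1536 = 8 * 192`. -/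
lemma upperTail_sub_ge {a ε : ℝ} (hε : 0 < ε) (ha : ε ≤ a) (ha' : 1536 ≤ ε ^ 3 * a) :
    8 * a * Real.exp (-a ^ 2 / 2) ≤ upperTail phi (a - ε) := by
  have h := mul_phi_le_upperTail (x := a - ε) (d := ε / 2) (by linarith) (by positivity)
  refine le_trans ?_ h
  rw [phi_eq]
  have e : Real.exp (-(a - ε + ε / 2) ^ 2 / 2)
      = Real.exp (-a ^ 2 / 2) * Real.exp (a * ε / 2 - ε ^ 2 / 8) := by
    rw [← Real.exp_add]; congr 1; ring
  have h0 : a * ε / 4 ≤ a * ε / 2 - ε ^ 2 / 8 := by nlinarith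
  have ha0 : 0 < a := hε.trans_le ha
  have h1 : (a * ε / 4) ^ 2 / 2 ≤ Real.exp (a * ε / 2 - ε ^ 2 / 8) := by
    refine le_trans ?_ (Real.exp_le_exp.2 h0)
    have hx : 0 ≤ a * ε / 4 := by positivity
    linarith [Real.quadratic_le_exp_of_nonneg hx]
  have hc := third_le_inv_sqrt_two_pi
  rw [e]
  calc 8 * a * Real.exp (-a ^ 2 / 2) = 1536 * (a / 192) * Real.exp (-a ^ 2 / 2) := by ring
    _ ≤ ε ^ 3 * a * (a / 192) * Real.exp (-a ^ 2 / 2) := by gcongr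
    _ = ε / 2 * (1 / 3 * (Real.exp (-a ^ 2 / 2) * ((a * ε / 4) ^ 2 / 2))) := by ring
    _ ≤ _ := by gcongr

theorem le_liminf_iSup_FNR {φ : ∀ n, Procedure n}
    (hφ : ∀ n, 0 < n → ∀ X : Fin n → ℝ, ∀ i j, |X i| ≤ |X j| → i ∈ φ n X → j ∈ φ n X)
    {s : ℕ → ℕ} (hs : Tendsto s atTop atTop)
    (hsn : Tendsto (fun n : ℕ => (s n : ℝ) / (n : ℝ)) atTop (𝓝 0)) {b : ℝ}
    (hsp : SparsityPreserving φ s (signalRate s) (fun n => signalClass n (s n) b)) :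
    gaussianReal 0 1 (Set.Ioi b) ≤
      liminf (fun n : ℕ => ⨆ θ ∈ signalClass n (s n) b, FNR (φ n) θ) atTop := by
  refine le_of_forall_lt fun c hc => ?_
  obtain ⟨c', hcc', hc'⟩ := exists_between hc
  refine hcc'.trans_le (le_liminf_of_le (by isBoundedDefault) ?_)
  obtain ⟨k, hk⟩ := exists_lt_gaussianReal_Icc hc'
  set ε : ℝ := 1 / (k + 1) with hε
  have hε0 : 0 < ε := by positivity
  set v := gaussianReal 0 1 (Set.Icc (-(k : ℝ)) (-b - ε)) with hv
  have hlim := Tendsto.add hsp (tendsto_exp_neg_sparsity hs)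
  rw [add_zero] at hlim
  have hr := tendsto_signalRate hs hsn
  filter_upwards [hlim.eventually_lt_const (tsub_pos_of_lt hk), eventually_pos_sparsity hs,
    -- `1 - b` makes `a + b` positive; `(k + ε - b)/2` puts `a + b - k` above `-(a - ε)`.
    hr.eventually_ge_atTop (max 1 (max ε (max (1 - b) ((k + ε - b) / 2)))),
    hr.eventually_ge_atTop (1536 / ε ^ 3),
    eventually_exp_signalRate hs hsn, eventually_two_mul_le hsn] with n h1 hn h2 h3 h4 h5
  simp only [max_le_iff] at h2
  obtain ⟨h2a, h2b, h2c, h2d⟩ := h2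
  rw [div_le_iff₀' (by positivity)] at h3
  have hn0 : (0 : ℝ) < n := by exact_mod_cast hn.1
  have hs1 : (1 : ℝ) ≤ s n := by exact_mod_cast hn.2
  have hsle : s n ≤ n := by
    have : (s n : ℝ) ≤ n := by linarith
    exact_mod_cast this
  obtain ⟨θ, hθ, hθv⟩ := exists_mem_signalClass hsle (b := b) (by
    rw [← signalRate]; linarith)
  rw [← signalRate] at hθv
  set a := signalRate s n with ha
  have hcard : (supp θ).card = s n := hθ.1
  have hbad := law_card_Ioi_le_le θ (x := a - ε) (a * s n)
  rw [hcard] at hbad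
  have hbad' : law θ {X | ((Finset.univ.filter fun i => a - ε < X i).card : ℝ) ≤ a * s n} ≤
      ENNReal.ofReal (Real.exp (-(s n / 4 : ℝ))) := by
    refine hbad.trans (ENNReal.ofReal_le_ofReal (Real.exp_le_exp.2 ?_))
    have h6 := upperTail_sub_ge hε0 h2b h3
    rw [h4] at h6
    -- Twice the required count, so the Chernoff exponent is at most `-a s`.
    have h7 : 2 * a * s n ≤ (n - s n) * (upperTail phi (a - ε) / 2) := by
      calc 2 * a * s n = n / 2 * (8 * a * (s n / n) / 2) := by field_simp; norm_num
        _ ≤ _ := by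
          gcongr ?_ * (?_ / 2) <;> linarith
    nlinarith
  -- The exceptional event is too many rejections or too few exceedances of `a - ε`. Off it,
  -- rejecting some `|X i| ≤ a - ε` would by monotonicity reject every exceedance, more than `a s`
  -- of them.
  have hfnr := le_FNR_add (φ n) θ (τ := a - ε) (v := v) (hcard ▸ hn.2) (fun i hi => by
      rw [hθv i hi, hv, ← gaussianReal_Icc_add (a + b)]
      exact measure_mono (Set.Icc_subset_Icc (by linarith) (by linarith)))
    (B := {X | a * (s n : ℝ) < ((φ n X).card : ℝ)} ∪
      {X | ((Finset.univ.filter fun i => a - ε < X i).card : ℝ) ≤ a * s n}) (fun X hX i hi => by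
      by_contra! hle
      refine hX ?_
      by_cases h : ((Finset.univ.filter fun i => a - ε < X i).card : ℝ) ≤ a * s n
      · exact Or.inr h
      · refine Or.inl ((not_le.1 h).trans_le ?_)
        refine Nat.cast_le.2 (Finset.card_le_card fun j hj => ?_)
        exact hφ n hn.1 X i j (hle.trans ((Finset.mem_filter.1 hj).2.le.trans (le_abs_self _))) hi)
  have hB := (measure_union_le _ _).trans (add_le_add
    (le_iSup₂_of_le (f := fun θ (_ : θ ∈ signalClass n (s n) b) =>
      law θ {X | a * (s n : ℝ) < ((φ n X).card : ℝ)}) θ hθ le_rfl) hbad')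
  have h8 := (lt_tsub_iff_right.1 h1).trans_le (hfnr.trans (add_le_add le_rfl hB))
  rw [add_comm] at h8
  exact (lt_of_add_lt_add_right h8).le.trans
    (le_iSup₂_of_le (f := fun θ (_ : θ ∈ signalClass n (s n) b) => FNR (φ n) θ) θ hθ le_rfl)

lemma clProc_monotone {n : ℕ} (hn : 0 < n) (t : ℝ) (X : Fin n → ℝ) (i j : Fin n)
    (h : |X i| ≤ |X j|) (hi : i ∈ clProc t n X) : j ∈ clProc t n X :=
  Finset.mem_filter.2 ⟨Finset.mem_univ _,
    (lval_antitone (wHat_mem_Ioc hn X) h).trans_lt (Finset.mem_filter.1 hi).2⟩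

lemma qProc_monotone {n : ℕ} (hn : 0 < n) (t : ℝ) (X : Fin n → ℝ) (i j : Fin n)
    (h : |X i| ≤ |X j|) (hi : i ∈ qProc t n X) : j ∈ qProc t n X :=
  Finset.mem_filter.2 ⟨Finset.mem_univ _,
    (qval_antitone (wHat_mem_Ioc hn X) h).trans_lt (Finset.mem_filter.1 hi).2⟩

end SparseTesting

theorem mainTheorem4 (t : ℝ) (ht0 : 0 < t) (ht1 : t < 1) (b : ℝ) (s : ℕ → ℕ)
    (hs : Tendsto s atTop atTop)
    (hsn : Tendsto (fun n : ℕ => (s n : ℝ) / (n : ℝ)) atTop (𝓝 0)) :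
    (∀ A : ℕ → ℝ, Tendsto A atTop atTop →
      SparseTesting.SparsityPreserving (SparseTesting.clProc t) s A
        (fun n => SparseTesting.signalClass n (s n) b) ∧
      SparseTesting.SparsityPreserving (SparseTesting.qProc t) s A
        (fun n => SparseTesting.signalClass n (s n) b)) ∧
    gaussianReal 0 1 (Set.Ioi b) ≤
      liminf (fun n : ℕ => ⨆ θ ∈ SparseTesting.signalClass n (s n) b,
        SparseTesting.FNR (SparseTesting.clProc t n) θ) atTop ∧
    gaussianReal 0 1 (Set.Ioi b) ≤
      liminf (fun n : ℕ => ⨆ θ ∈ SparseTesting.signalClass n (s n) b,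
        SparseTesting.FNR (SparseTesting.qProc t n) θ) atTop := by
  have hcl : ∀ A : ℕ → ℝ, Tendsto A atTop atTop →
      SparseTesting.SparsityPreserving (SparseTesting.clProc t) s A
        (fun n => SparseTesting.signalClass n (s n) b) := fun A hA =>
    -- Any `c` strictly between `t` and `1` would serve; the midpoint is taken.
    SparseTesting.sparsityPreserving_of_card_le (c := (1 + t) / 2)
      (C := (1 + t) / 2 / ((1 + t) / 2 - t)) (by linarith) (by linarith)
      (div_pos (by linarith) (by linarith))
      (fun n hn X => SparseTesting.card_clProc_le hn ht0.le (by linarith) X) hs hsn hA b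
  have hq : ∀ A : ℕ → ℝ, Tendsto A atTop atTop →
      SparseTesting.SparsityPreserving (SparseTesting.qProc t) s A
        (fun n => SparseTesting.signalClass n (s n) b) := fun A hA =>
    SparseTesting.sparsityPreserving_of_card_le ht0 ht1 one_pos
      (fun n _ X => by rw [one_mul, SparseTesting.qProc]) hs hsn hA b
  have hr := SparseTesting.tendsto_signalRate hs hsn
  exact ⟨fun A hA => ⟨hcl A hA, hq A hA⟩,
    SparseTesting.le_liminf_iSup_FNR
      (fun n hn => SparseTesting.clProc_monotone hn t) hs hsn (hcl _ hr),
    SparseTesting.le_liminf_iSup_FNR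
      (fun n hn => SparseTesting.qProc_monotone hn t) hs hsn (hq _ hr)⟩
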